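/- Let $r\ge 1$. An $r$-Dyck path of length $n$ is a lattice path from $(0,0)$ to $(rn,n)$ with steps $(0,1)$ (written as the letter $0$) and $(1,0)$ (written as the letter $1$) that never goes below the line $y=x/r$; it is regarded as a word in $\{0,1\}$. Let $\mathcal P^r_n$ be the set of these paths. For a word $w=w_1w_2\cdots w_\ell$ in $\{0,1\}$ put $$\mathrm{Des}(w)=\{i : 1\le i<\ell,\ w_i>w_{i+1}\},\qquad \mathrm{maj}(w)=\sum_{i\in \mathrm{Des}(w)} i,$$ $$\alpha(w)=\sum_{i\in\mathrm{Des}(w)}|\{j\le i : w_j=0\}|,\qquad \beta(w)=\sum_{i\in\mathrm{Des}(w)}|\{j\le i: w_j=1\}|.$$ **Theorem.** Let $K$ be a commutative ring, let $a\in K$ be invertible and let $b\in K$ (for example $a,b$ indeterminates and $K=\mathbb Z[a,a^{-1},b]$). Let $(E_n(x))_{n\ge0}$ be a sequence of polynomials in $K[x]$ with $E_0(x)=1$. The following are equivalent. 1. For all $n\ge 0$, $\displaystyle E_n(x)=\sum_{d\in\mathcal P^r_n}x^{|\mathrm{Des}(d)|}a^{\alpha(d)}b^{\beta(d)}$. 2.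 In the ring $K[x][[z]]$ of formal power series, $$z=\sum_{n=1}^{\infty}\frac{a^{-\binom n2}E_n(x)\,z^n}{(1+a^{-1}z)\cdots(1+a^{-n}z)\,(1+xbz)\cdots(1+xb^{rn}z)}.$$ 3. For all $n\ge0$, $$E_{n+1}(x)=\sum_{n_0+n_1+\cdots+n_r=n}E_{n_0}(ax)\prod_{i=1}^{r}E_{n_i}\bigl(a^{d_1(i)}b^{d_2(i)}x\bigr)\bigl(a^{d_1(i)}b^{d_2(i)}x\bigr)^{\delta(n_i>0)},$$ where $n_0,\dots,n_r\ge0$, $\delta(P)$ is $1$ if $P$ is true and $0$ otherwise, and $$d_1(i)=1+\sum_{j=0}^{i-1}n_j,\qquad d_2(i)=i+r\sum_{j=0}^{i-1}n_j .$$ **Proposition.** Let $q\in K$ be invertible (for example an indeterminate, $K=\mathbb Z[q,q^{-1}]$), and put $(y;q)_m=(1-y)(1-qy)\cdots(1-q^{m-1}y)$. A sequence $(E_n(q))_{n\ge0}$ in $K$ with $E_0(q)=1$ satisfies, in $K[[z]]$, $$z=\sum_{n=1}^{\infty}\frac{E_n(q)\,z^n}{q^{\binom n2}(-q^{-n}z;q)_n(-qz;q)_{rn}}$$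 if and only if $\sum_{d\in\mathcal P^r_n}q^{\mathrm{maj}(d)}=E_n(q)$ for all $n\ge0$. Moreover, for every $q\in K$ and $n\ge0$, the polynomial in item 1 takes at $(a,b,x)=(q,q,1)$ the value $\sum_{d\in\mathcal P^r_n}q^{\mathrm{maj}(d)}$. -/

import Mathlib

noncomputable section

namespace RDyck

/-! ### Words and their statistics

Words in the letters `0` and `1` are lists over `Fin 2`; positions are counted from `1`. -/

/-- The descent set `{i : 1 ≤ i < |w|, w_i > w_{i+1}}` of a word `w = w_1 w_2 ...`
(the letter `w_i` is `w.getD (i - 1) 0`). -/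
def Des (w : List (Fin 2)) : Finset ℕ :=
  (Finset.Ico 1 w.length).filter fun i => w.getD i 0 < w.getD (i - 1) 0

/-- The major index: the sum of the descents. -/
def maj (w : List (Fin 2)) : ℕ := ∑ i ∈ Des w, i

/-- The sum over the descents `i` of the number of letters `0` among the first `i` letters. -/
def alpha (w : List (Fin 2)) : ℕ := ∑ i ∈ Des w, (w.take i).count 0

/-- The sum over the descents `i` of the number of letters `1` among the first `i` letters. -/
def beta (w : List (Fin 2)) : ℕ := ∑ i ∈ Des w, (w.take i).count 1

/-! ### `r`-Dyck paths -/

/-- The word `w` (`0` = up step, `1` = right step) is a lattice path from `(0,0)` to `(rn,n)`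
that never goes below the line `y = x / r`: after each number `i` of steps, the current
point `(x, y)` satisfies `x ≤ r * y`. -/
def IsDyckPath (r n : ℕ) (w : List (Fin 2)) : Prop :=
  w.count 0 = n ∧ w.count 1 = r * n ∧ ∀ i, (w.take i).count 1 ≤ r * (w.take i).count 0

theorem finite_isDyckPath (r n : ℕ) : {w | IsDyckPath r n w}.Finite := by
  refine (List.finite_length_eq (Fin 2) (n + r * n)).subset ?_
  rintro w ⟨h0, h1, -⟩
  have key : ∀ l : List (Fin 2), l.length = l.count 0 + l.count 1 := by
    intro l
    induction l with
    | nil => rfl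
    | cons c l ih => fin_cases c <;> simp [ih] <;> omega
  simp [key w, h0, h1]

/-- The finite set of `r`-Dyck paths of length `n`. -/
def dyckPaths (r n : ℕ) : Finset (List (Fin 2)) := (finite_isDyckPath r n).toFinset

/-! ### Formal power series -/

/-- The infinite series `∑ f n` of formal power series converges to `s` coefficientwise
(that is, each coefficient of the partial sums is eventually constant). -/
def HasFormalSum {R : Type*} [CommRing R] (f : ℕ → PowerSeries R) (s : PowerSeries R) : Prop :=
  letI : TopologicalSpace R := ⊥
  letI : TopologicalSpace (PowerSeries R) :=
    PowerSeries.WithPiTopology.instTopologicalSpace R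
  HasSum f s

/-- The quotient `f / g` of formal power series, for `g` with constant coefficient `1`. -/
def divSeries {R : Type*} [CommRing R] (f g : PowerSeries R) : PowerSeries R :=
  f * PowerSeries.invOfUnit g 1

/-- The `q`-Pochhammer symbol `(x; q)_n = (1 - x)(1 - q x) ⋯ (1 - q ^ (n - 1) x)`. -/
def qPochhammer {R : Type*} [CommRing R] (x q : R) (n : ℕ) : R :=
  ∏ i ∈ Finset.range n, (1 - q ^ i * x)

/-! ### The refined generating function

`x` is the polynomial variable, the coefficients lie in a commutative ring `K`. The elements
`a`, `b` of `K` may in particular be indeterminates, as for the ring of polynomials in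
`a, a⁻¹, b` over the integers. -/

variable {K : Type*} [CommRing K]

/-- The generating function
`∑_d x ^ |Des d| * a ^ α(d) * b ^ β(d)` over all `r`-Dyck paths `d` of length `n`. -/
def genFun (r n : ℕ) (a b : K) : Polynomial K :=
  ∑ d ∈ dyckPaths r n,
    Polynomial.X ^ (Des d).card * Polynomial.C (a ^ alpha d) * Polynomial.C (b ^ beta d)

/-- The denominator
`(1 + a⁻¹ z) ⋯ (1 + a⁻ⁿ z) * (1 + x b z) ⋯ (1 + x b ^ (r n) z)`,
a power series in `z` whose coefficients are polynomials in `x`. -/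
def expansionDenom (r n : ℕ) (a : Kˣ) (b : K) : PowerSeries (Polynomial K) :=
  (∏ i ∈ Finset.Icc 1 n,
    (1 + PowerSeries.C (Polynomial.C (((a⁻¹ ^ i : Kˣ) : K))) * PowerSeries.X)) *
  ∏ i ∈ Finset.Icc 1 (r * n),
    (1 + PowerSeries.C (Polynomial.X * Polynomial.C (b ^ i)) * PowerSeries.X)

/-- The `n`-th term of the expansion formula for `z`:
`a ^ (-(n choose 2)) * E_n(x) * z ^ n` over the denominator above. -/
def expansionTerm (r : ℕ) (a : Kˣ) (b : K) (E : ℕ → Polynomial K) (n : ℕ) :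
    PowerSeries (Polynomial K) :=
  divSeries
    (PowerSeries.C (Polynomial.C ((a⁻¹ ^ n.choose 2 : Kˣ) : K) * E n) * PowerSeries.X ^ n)
    (expansionDenom r n a b)

/-- The expansion formula `z = ∑_{n ≥ 1} (n-th term)`. -/
def SatisfiesExpansion (r : ℕ) (a : Kˣ) (b : K) (E : ℕ → Polynomial K) : Prop :=
  HasFormalSum (fun k => expansionTerm r a b E (k + 1)) PowerSeries.X

/-- The substitution `x ↦ c * x` in a polynomial in `x`. -/
def scaleVar (c : K) (P : Polynomial K) : Polynomial K :=
  P.comp (Polynomial.C c * Polynomial.X)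

/-- `d₁(i) = 1 + n_0 + ⋯ + n_{i-1}`. -/
def d1 {r : ℕ} (m : Fin (r + 1) → ℕ) (i : Fin (r + 1)) : ℕ :=
  1 + ∑ j ∈ Finset.univ.filter (· < i), m j

/-- `d₂(i) = i + r * (n_0 + ⋯ + n_{i-1})`. -/
def d2 {r : ℕ} (m : Fin (r + 1) → ℕ) (i : Fin (r + 1)) : ℕ :=
  (i : ℕ) + r * ∑ j ∈ Finset.univ.filter (· < i), m j

/-- The recurrence: for all `n`, `E_{n+1}(x)` is the sum over all `(n_0, ..., n_r)` with
`n_0 + ⋯ + n_r = n` of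
`E_{n_0}(a x) * ∏_{i=1}^r E_{n_i}(c_i x) * (c_i x) ^ δ(n_i > 0)`,
where `c_i = a ^ d₁(i) * b ^ d₂(i)`. The index `i = 1, ..., r` is `i.succ` with `i : Fin r`. -/
def SatisfiesRecurrence (r : ℕ) (a b : K) (E : ℕ → Polynomial K) : Prop :=
  ∀ n, E (n + 1) =
    ∑ m ∈ Finset.Nat.antidiagonalTuple (r + 1) n,
      scaleVar a (E (m 0)) *
        ∏ i : Fin r,
          (scaleVar (a ^ d1 m i.succ * b ^ d2 m i.succ) (E (m i.succ)) *
            (Polynomial.C (a ^ d1 m i.succ * b ^ d2 m i.succ) * Polynomial.X) ^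
              (if 0 < m i.succ then 1 else 0))

/-! ### The `q`-analogue of the Fuss–Catalan numbers -/

/-- The expansion formula that defines the numbers `e_n = E_n(q)`:
`z = ∑_{n ≥ 1} e_n z ^ n / (q ^ (n choose 2) * (-q⁻ⁿ z; q)_n * (-q z; q)_{r n})`. -/
def SatisfiesQExpansion (r : ℕ) (q : Kˣ) (e : ℕ → K) : Prop :=
  HasFormalSum
    (fun k =>
      let n := k + 1
      divSeries
        (PowerSeries.C (((q⁻¹ ^ n.choose 2 : Kˣ) : K) * e n) * PowerSeries.X ^ n)
        (qPochhammer (-(PowerSeries.C ((q⁻¹ ^ n : Kˣ) : K) * PowerSeries.X))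
            (PowerSeries.C (q : K)) n *
          qPochhammer (-(PowerSeries.C (q : K) * PowerSeries.X))
            (PowerSeries.C (q : K)) (r * n)))
    PowerSeries.X

end RDyck

end

noncomputable section

namespace RDyck

/-! For item 2, let T(i,j) be the sum of the weights of the words above the line with i letters 0
and j letters 1, and D(i,j) the part from words ending in 0. Deleting letters at the end gives
T(i,j+1) = D(i,j+1) + T(i,j) and D(i+1,j+1) = D(i,j+1) + x a^i b^(j+1) T(i,j). With W_j the
reciprocal of (1+xbz)⋯(1+xb^j z) and S_i = 1 + ∑_j D(i,j) W_j, summation by parts turns this into z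
S_{i+1} = (z + a^i) S_i - a^i W_{ri} T(i,ri) (`X_mul_rowSeries_succ`). Since T(i,ri) is the path
polynomial, multiplying by `rowWeight` makes the terms of item 2 telescope to z
(`hasFormalSum_of_rows`). Conversely, term n begins with a unit times E_n z^n, so the expansion
determines E (`HasFormalSum.coeff_unique`).

For item 3, a nonempty path is uniquely 0 P_0 1 P_1 ⋯ 1 P_r with Dyck paths P_i, cut at first
passages (`sum_bounded_add_one`). Moving the starting point of P_i rescales x (`scaleVar_weight`),
and each nonempty P_i with i ≥ 1 creates one more descent where it joins the preceding 1.

The Proposition is item 2 at a = b = q under x ↦ 1, because maj = α + β. -/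

/-! ### Formal sums and quotients of power series -/

open PowerSeries in
theorem hasFormalSum_iff {R : Type*} [CommRing R] {f : ℕ → PowerSeries R} {s : PowerSeries R}
    (h : ∀ k, (X : PowerSeries R) ^ (k + 1) ∣ f k) :
    HasFormalSum f s ↔ ∀ d, ∑ k ∈ Finset.range d, coeff d (f k) = coeff d s := by
  unfold HasFormalSum
  let _ : TopologicalSpace R := ⊥
  have : DiscreteTopology R := ⟨rfl⟩
  rw [PowerSeries.WithPiTopology.hasSum_iff_hasSum_coeff]
  refine forall_congr' fun d => ?_
  have hs : HasSum (fun k => coeff d (f k)) (∑ k ∈ Finset.range d, coeff d (f k)) := by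
    -- Terms with k ≥ d are divisible by z^(d+1), so only finitely many reach degree d.
    refine hasSum_sum_of_ne_finset_zero fun k hk => ?_
    rw [Finset.mem_range, not_lt] at hk
    exact X_pow_dvd_iff.mp (h k) d (by omega)
  exact ⟨fun h' => hs.unique h', fun h' => h' ▸ hs⟩

open PowerSeries in
theorem divSeries_eq_iff {R : Type*} [CommRing R] {f g y : PowerSeries R}
    (hg : constantCoeff g = 1) : divSeries f g = y ↔ f = y * g := by
  have h1 : g * invOfUnit g 1 = 1 := mul_invOfUnit g 1 (by simpa using hg)
  constructor
  · rintro rfl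
    rw [divSeries, mul_assoc, mul_comm _ g, h1, mul_one]
  · rintro rfl
    rw [divSeries, mul_assoc, h1, mul_one]

open PowerSeries in
theorem map_divSeries {R S : Type*} [CommRing R] [CommRing S] (φ : R →+* S)
    {f g : PowerSeries R} (hg : constantCoeff g = 1) :
    PowerSeries.map φ (divSeries f g) = divSeries (PowerSeries.map φ f) (PowerSeries.map φ g) := by
  symm
  rw [divSeries_eq_iff, ← map_mul, ← (divSeries_eq_iff hg).mp rfl]
  rw [← coeff_zero_eq_constantCoeff_apply] at hg ⊢
  simp [hg]

open PowerSeries in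
theorem X_pow_dvd_divSeries {R : Type*} [CommRing R] (c : R) (g : PowerSeries R) (n : ℕ) :
    (X : PowerSeries R) ^ n ∣ divSeries (C c * X ^ n) g :=
  ⟨C c * invOfUnit g 1, by rw [divSeries]; ring⟩

open PowerSeries in
theorem coeff_divSeries_self {R : Type*} [CommRing R] (c : R) (g : PowerSeries R) (n : ℕ) :
    coeff n (divSeries (C c * X ^ n) g) = c := by
  have : divSeries (C c * X ^ n) g = C c * (invOfUnit g 1 * X ^ n) := by
    rw [divSeries]; ring
  rw [this, coeff_C_mul, coeff_mul_X_pow', if_pos le_rfl, Nat.sub_self,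
    coeff_zero_eq_constantCoeff_apply, constantCoeff_invOfUnit]
  simp

/-- A formal series whose terms are `u n * e n * z ^ n / g n` with `u n` invertible determines
the coefficients `e n`. -/
theorem HasFormalSum.coeff_unique {R : Type*} [CommRing R] {u : ℕ → Rˣ} {e e' : ℕ → R}
    {g : ℕ → PowerSeries R} {s : PowerSeries R}
    (h : HasFormalSum (fun k => divSeries
      (PowerSeries.C ((u (k + 1) : R) * e (k + 1)) * PowerSeries.X ^ (k + 1)) (g (k + 1))) s)
    (h' : HasFormalSum (fun k => divSeries
      (PowerSeries.C ((u (k + 1) : R) * e' (k + 1)) * PowerSeries.X ^ (k + 1)) (g (k + 1))) s)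
    (n : ℕ) : e (n + 1) = e' (n + 1) := by
  rw [hasFormalSum_iff fun k => X_pow_dvd_divSeries _ _ _] at h h'
  induction n using Nat.strong_induction_on with
  | _ n ih =>
    have hn := (h (n + 1)).trans (h' (n + 1)).symm
    rw [Finset.sum_range_succ, Finset.sum_range_succ, coeff_divSeries_self,
      coeff_divSeries_self] at hn
    have hs : ∑ k ∈ Finset.range n, PowerSeries.coeff (n + 1) (divSeries
          (PowerSeries.C ((u (k + 1) : R) * e (k + 1)) * PowerSeries.X ^ (k + 1)) (g (k + 1))) =
        ∑ k ∈ Finset.range n, PowerSeries.coeff (n + 1) (divSeries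
          (PowerSeries.C ((u (k + 1) : R) * e' (k + 1)) * PowerSeries.X ^ (k + 1)) (g (k + 1))) :=
      Finset.sum_congr rfl fun k hk => by rw [ih k (Finset.mem_range.mp hk)]
    rw [hs] at hn
    exact (u (n + 1)).mul_right_inj.mp (add_left_cancel hn)

/-- Summation by parts; it moves the difference from the column weights to the path sums. -/
theorem sum_range_sub_mul {S : Type*} [CommRing S] (B G : ℕ → S) (M : ℕ) :
    ∑ j ∈ Finset.range M, (B j - B (j + 1)) * G j =
      B 0 * G 0 - B M * G M + ∑ j ∈ Finset.range M, B (j + 1) * (G (j + 1) - G j) := by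
  induction M with
  | zero => simp
  | succ M ih => rw [Finset.sum_range_succ, Finset.sum_range_succ, ih]; ring

open PowerSeries in
theorem constantCoeff_prod_one_add {R : Type*} [CommRing R] (s : Finset ℕ) (c : ℕ → R) :
    constantCoeff (∏ i ∈ s, (1 + C (c i) * X)) = 1 := by
  rw [map_prod]
  exact Finset.prod_eq_one fun i _ => by simp

/-! ### The telescoping expansion, for abstract arrays T and D -/

section Telescope

open PowerSeries

variable {R : Type*} [CommRing R] (r : ℕ) (a : Rˣ) (b x : R)

/-- The reciprocal of `(1 + x b z) ⋯ (1 + x b ^ j z)`. -/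
def columnWeight (j : ℕ) : PowerSeries R :=
  divSeries 1 (∏ i ∈ Finset.Icc 1 j, (1 + C (x * b ^ i) * X))

/-- The series `a ^ (-(n + 1 choose 2)) * z ^ n / ((1 + a⁻¹ z) ⋯ (1 + a⁻ⁿ z))`. -/
def rowWeight (n : ℕ) : PowerSeries R :=
  divSeries (C ((a⁻¹ ^ (n + 1).choose 2 : Rˣ) : R) * X ^ n)
    (∏ i ∈ Finset.Icc 1 n, (1 + C ((a⁻¹ ^ i : Rˣ) : R) * X))

theorem columnWeight_mul_prod (j : ℕ) :
    columnWeight b x j * ∏ i ∈ Finset.Icc 1 j, (1 + C (x * b ^ i) * X) = 1 :=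
  ((divSeries_eq_iff (constantCoeff_prod_one_add _ _)).mp rfl).symm

theorem rowWeight_mul_prod (n : ℕ) :
    rowWeight a n * ∏ i ∈ Finset.Icc 1 n, (1 + C ((a⁻¹ ^ i : Rˣ) : R) * X) =
      C ((a⁻¹ ^ (n + 1).choose 2 : Rˣ) : R) * X ^ n :=
  ((divSeries_eq_iff (constantCoeff_prod_one_add _ _)).mp rfl).symm

theorem columnWeight_zero : columnWeight b x 0 = 1 := by
  simpa using columnWeight_mul_prod b x 0

theorem rowWeight_zero : rowWeight a 0 = 1 := by
  simpa using rowWeight_mul_prod a 0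

theorem columnWeight_succ (j : ℕ) :
    columnWeight b x j = columnWeight b x (j + 1) * (1 + C (x * b ^ (j + 1)) * X) := by
  have h := columnWeight_mul_prod b x (j + 1)
  rw [Finset.prod_Icc_succ_top (by omega)] at h
  refine (divSeries_eq_iff (constantCoeff_prod_one_add _ _)).mpr ?_
  exact h.symm.trans (by ring)

/-- The ratio of consecutive row weights is tuned to the factor z + a^i in the relation between
consecutive row series. -/
theorem rowWeight_succ (n : ℕ) :
    X * rowWeight a n = (X + C ((a ^ (n + 1) : Rˣ) : R)) * rowWeight a (n + 1) := by
  set p := ∏ i ∈ Finset.Icc 1 n, (1 + C ((a⁻¹ ^ i : Rˣ) : R) * X) with hp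
  have hu : IsUnit (p * (1 + C ((a⁻¹ ^ (n + 1) : Rˣ) : R) * X)) := by
    rw [isUnit_iff_constantCoeff, map_mul, hp, constantCoeff_prod_one_add]
    simp
  refine hu.mul_right_cancel ?_
  have h1 := rowWeight_mul_prod a n
  have h2 := rowWeight_mul_prod a (n + 1)
  rw [Finset.prod_Icc_succ_top (by omega), ← hp] at h2
  rw [← hp] at h1
  rw [mul_assoc _ (rowWeight a (n + 1)), h2]
  have e1 : X * rowWeight a n * (p * (1 + C ((a⁻¹ ^ (n + 1) : Rˣ) : R) * X)) =
      X * (rowWeight a n * p) * (1 + C ((a⁻¹ ^ (n + 1) : Rˣ) : R) * X) := by ring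
  have e2 : (C ((a⁻¹ ^ (n + 1 + 1).choose 2 : Rˣ) : R) : PowerSeries R) =
      C ((a⁻¹ ^ (n + 1).choose 2 : Rˣ) : R) * C ((a⁻¹ ^ (n + 1) : Rˣ) : R) := by
    rw [← map_mul, ← Units.val_mul, ← pow_add, Nat.choose_succ_succ' (n + 1) 1,
      Nat.choose_one_right, add_comm]
  have e3 : (C ((a ^ (n + 1) : Rˣ) : R) * C ((a⁻¹ ^ (n + 1) : Rˣ) : R) : PowerSeries R) = 1 := by
    rw [← map_mul, ← Units.val_mul, inv_pow, mul_inv_cancel]; simp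
  rw [e1, h1, e2]
  linear_combination (-X ^ (n + 1) * C ((a⁻¹ ^ (n + 1).choose 2 : Rˣ) : R)) * e3

variable (T D : ℕ → ℕ → R)

/-- The series `1 + ∑_j D n j / ((1 + x b z) ⋯ (1 + x b ^ j z))`, over `1 ≤ j ≤ r * (n - 1)`. -/
def rowSeries (n : ℕ) : PowerSeries R :=
  1 + ∑ j ∈ Finset.range (r * (n - 1)), columnWeight b x (j + 1) * C (D n (j + 1))

variable {r a b x T D}

/-- Since W_j - W_{j+1} = x b^(j+1) z W_{j+1}, the new term of D(i+1,j+1) contributes a^i (W_j -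
W_{j+1}) T(i,j), and summation by parts returns a sum of D(i,j+1) W_{j+1} plus boundary terms. -/
theorem X_mul_rowSeries_succ {i : ℕ} (hT0 : T i 0 = 1)
    (hT : ∀ j < r * i, T i (j + 1) = D i (j + 1) + T i j)
    (hDz : ∀ j, r * (i - 1) ≤ j → D i (j + 1) = 0)
    (hD : ∀ j < r * i,
      D (i + 1) (j + 1) = D i (j + 1) + x * (a : R) ^ i * b ^ (j + 1) * T i j) :
    X * rowSeries r b x D (i + 1) = (X + C ((a ^ i : Rˣ) : R)) * rowSeries r b x D i -
      C ((a ^ i : Rˣ) : R) * columnWeight b x (r * i) * C (T i (r * i)) := by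
  -- Row i may be summed over the longer range of row i + 1, as the added entries vanish.
  have hext : rowSeries r b x D i =
      1 + ∑ j ∈ Finset.range (r * i), columnWeight b x (j + 1) * C (D i (j + 1)) := by
    rw [rowSeries]
    congr 1
    refine Finset.sum_subset ?_ fun j _ hj => ?_
    · exact Finset.range_subset_range.mpr (Nat.mul_le_mul_left r (Nat.sub_le i 1))
    · rw [Finset.mem_range, not_lt] at hj
      rw [hDz j hj]; simp
  have hab := sum_range_sub_mul (columnWeight b x) (fun j => C (T i j)) (r * i)
  have h1 : ∑ j ∈ Finset.range (r * i), columnWeight b x (j + 1) * (C (T i (j + 1)) - C (T i j)) =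
      ∑ j ∈ Finset.range (r * i), columnWeight b x (j + 1) * C (D i (j + 1)) :=
    Finset.sum_congr rfl fun j hj => by
      rw [hT j (Finset.mem_range.mp hj), map_add, add_sub_cancel_right]
  have h2 : X * ∑ j ∈ Finset.range (r * i), columnWeight b x (j + 1) * C (D (i + 1) (j + 1)) =
      X * ∑ j ∈ Finset.range (r * i), columnWeight b x (j + 1) * C (D i (j + 1)) +
      C ((a ^ i : Rˣ) : R) *
        ∑ j ∈ Finset.range (r * i),
          (columnWeight b x j - columnWeight b x (j + 1)) * C (T i j) := by
    rw [Finset.mul_sum, Finset.mul_sum, Finset.mul_sum, ← Finset.sum_add_distrib]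
    refine Finset.sum_congr rfl fun j hj => ?_
    rw [hD j (Finset.mem_range.mp hj), columnWeight_succ b x j]
    simp only [map_add, map_mul, Units.val_pow_eq_pow_val]
    ring
  rw [h1, hT0, columnWeight_zero] at hab
  rw [hab] at h2
  rw [hext, rowSeries, Nat.add_sub_cancel, mul_add, h2, map_one]
  ring

/-- Term k is F_k - F_{k+1}, where F_k is z times row weight k times row series k + 1; F_0 = z, and
F_d is divisible by z^(d+1). -/
theorem hasFormalSum_of_rows (hT0 : ∀ i, 1 ≤ i → T i 0 = 1)
    (hT : ∀ i, 1 ≤ i → ∀ j < r * i, T i (j + 1) = D i (j + 1) + T i j)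
    (hDz : ∀ i, 1 ≤ i → ∀ j, r * (i - 1) ≤ j → D i (j + 1) = 0)
    (hD : ∀ i, 1 ≤ i → ∀ j < r * i,
      D (i + 1) (j + 1) = D i (j + 1) + x * (a : R) ^ i * b ^ (j + 1) * T i j) :
    HasFormalSum (fun k => divSeries
      (C (((a⁻¹ ^ (k + 1).choose 2 : Rˣ) : R) * T (k + 1) (r * (k + 1))) * X ^ (k + 1))
      ((∏ i ∈ Finset.Icc 1 (k + 1), (1 + C ((a⁻¹ ^ i : Rˣ) : R) * X)) *
        ∏ i ∈ Finset.Icc 1 (r * (k + 1)), (1 + C (x * b ^ i) * X))) X := by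
  have hterm : ∀ k, divSeries
      (C (((a⁻¹ ^ (k + 1).choose 2 : Rˣ) : R) * T (k + 1) (r * (k + 1))) * X ^ (k + 1))
      ((∏ i ∈ Finset.Icc 1 (k + 1), (1 + C ((a⁻¹ ^ i : Rˣ) : R) * X)) *
        ∏ i ∈ Finset.Icc 1 (r * (k + 1)), (1 + C (x * b ^ i) * X)) =
      X * rowWeight a k * rowSeries r b x D (k + 1) -
        X * rowWeight a (k + 1) * rowSeries r b x D (k + 2) := by
    intro k
    have hk : 1 ≤ k + 1 := by omega
    have hrow := X_mul_rowSeries_succ (a := a) (hT0 _ hk) (hT _ hk) (hDz _ hk) (hD _ hk)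
    have e : X * rowWeight a k * rowSeries r b x D (k + 1) -
        X * rowWeight a (k + 1) * rowSeries r b x D (k + 2) =
        C ((a ^ (k + 1) : Rˣ) : R) * rowWeight a (k + 1) * columnWeight b x (r * (k + 1)) *
          C (T (k + 1) (r * (k + 1))) := by
      rw [rowWeight_succ]
      linear_combination (-rowWeight a (k + 1)) * hrow
    rw [e, divSeries_eq_iff (by
      rw [map_mul, constantCoeff_prod_one_add, constantCoeff_prod_one_add, one_mul])]
    have h1 := rowWeight_mul_prod a (k + 1)
    have h2 := columnWeight_mul_prod b x (r * (k + 1))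
    have e2 : (C ((a⁻¹ ^ (k + 1).choose 2 : Rˣ) : R) : PowerSeries R) =
        C ((a ^ (k + 1) : Rˣ) : R) * C ((a⁻¹ ^ (k + 2).choose 2 : Rˣ) : R) := by
      rw [← map_mul, ← Units.val_mul, Nat.choose_succ_succ' (k + 1) 1,
        Nat.choose_one_right, pow_add a⁻¹ (k + 1), ← mul_assoc, inv_pow a (k + 1), mul_inv_cancel,
        one_mul]
    rw [map_mul, e2]
    linear_combination (-C ((a ^ (k + 1) : Rˣ) : R) * C (T (k + 1) (r * (k + 1)))) * h1 -
      (C ((a ^ (k + 1) : Rˣ) : R) * rowWeight a (k + 1) * C (T (k + 1) (r * (k + 1))) *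
        ∏ i ∈ Finset.Icc 1 (k + 1), (1 + C ((a⁻¹ ^ i : Rˣ) : R) * X)) * h2
  rw [hasFormalSum_iff fun k => X_pow_dvd_divSeries _ _ _]
  intro d
  rw [← map_sum, Finset.sum_congr rfl fun k _ => hterm k,
    Finset.sum_range_sub' fun k => X * rowWeight a k * rowSeries r b x D (k + 1)]
  have h1 : rowSeries r b x D (0 + 1) = 1 := by simp [rowSeries]
  rw [rowWeight_zero, h1, mul_one, mul_one, map_sub, sub_eq_self]
  have : (X : PowerSeries R) ^ (d + 1) ∣ X * rowWeight a d * rowSeries r b x D (d + 1) := by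
    rw [pow_succ']
    exact ((mul_dvd_mul_left X (X_pow_dvd_divSeries _ _ _))).mul_right _
  exact X_pow_dvd_iff.mp this d (by omega)

end Telescope

/-! ### Weights of words -/

open Polynomial

variable {K : Type*} [CommRing K]

/-- The weight of a word `w` that is read after a letter `p` from the point with `i` letters `0`
and `j` letters `1` before it: the product of `x * a ^ i' * b ^ j'` over its descents, where
`i'` and `j'` count the letters `0` and `1` up to the descent. -/
def weight (a b : K) : Fin 2 → ℕ → ℕ → List (Fin 2) → Polynomial K
  | _, _, _, [] => 1
  | p, i, j, c :: w =>
    (if c < p then C (a ^ i * b ^ j) * X else 1) *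
      weight a b c (i + if c = 0 then 1 else 0) (j + if c = 1 then 1 else 0) w

variable (a b : K)

theorem weight_append (p : Fin 2) (i j : ℕ) (u v : List (Fin 2)) :
    weight a b p i j (u ++ v) =
      weight a b p i j u * weight a b (u.getLastD p) (i + u.count 0) (j + u.count 1) v := by
  induction u generalizing p i j with
  | nil => simp [weight]
  | cons c u ih =>
    rw [List.cons_append, weight, weight, ih, mul_assoc, List.getLastD_cons, List.count_cons,
      List.count_cons]
    simp only [beq_iff_eq, add_assoc, add_comm]

/-- Every descent carries exactly one factor x, so rescaling x amounts to translating the starting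
point. -/
theorem scaleVar_weight (i j : ℕ) (p : Fin 2) (i' j' : ℕ) (w : List (Fin 2)) :
    scaleVar (a ^ i * b ^ j) (weight a b p i' j' w) = weight a b p (i + i') (j + j') w := by
  induction w generalizing p i' j' with
  | nil => simp [weight, scaleVar]
  | cons c w ih =>
    rw [weight, weight, scaleVar, mul_comp, ← scaleVar, ← scaleVar, ih, add_assoc, add_assoc]
    congr 1
    split_ifs
    · simp [scaleVar]; ring
    · simp [scaleVar]

theorem weight_eq_prod (p : Fin 2) (i j : ℕ) (w : List (Fin 2)) :
    weight a b p (i + if p = 0 then 1 else 0) (j + if p = 1 then 1 else 0) w =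
      ∏ k ∈ Finset.range w.length,
        if (p :: w).getD (k + 1) 0 < (p :: w).getD k 0 then
          C (a ^ (i + ((p :: w).take (k + 1)).count 0) *
            b ^ (j + ((p :: w).take (k + 1)).count 1)) * X
        else 1 := by
  induction w generalizing p i j with
  | nil => simp [weight]
  | cons c w ih =>
    rw [weight, ih, List.length_cons, Finset.prod_range_succ', mul_comm]
    congr 1
    · refine Finset.prod_congr rfl fun k _ => ?_
      simp only [List.getD_cons_succ, List.take_succ_cons, List.count_cons, beq_iff_eq]
      refine if_congr Iff.rfl ?_ rfl
      congr 4 <;> ring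
    · simp [List.count_cons]

theorem prod_Des (w : List (Fin 2)) :
    X ^ (Des w).card * C (a ^ alpha w) * C (b ^ beta w) = weight a b 0 0 0 w := by
  have h : X ^ (Des w).card * C (a ^ alpha w) * C (b ^ beta w) =
      ∏ i ∈ Des w, (C (a ^ (w.take i).count 0 * b ^ (w.take i).count 1) * X) := by
    rw [Finset.prod_mul_distrib, Finset.prod_const, ← map_prod, Finset.prod_mul_distrib,
      Finset.prod_pow_eq_pow_sum, Finset.prod_pow_eq_pow_sum, map_mul]
    rw [← alpha, ← beta]
    ring
  rw [h, Des, Finset.prod_filter]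
  cases w with
  | nil => simp [weight]
  | cons c w =>
    -- The fictitious letter 0 before the word never creates a descent.
    have h0 : ¬ c < 0 := by simp
    rw [weight, if_neg h0, one_mul, weight_eq_prod, List.length_cons,
      Finset.prod_Ico_eq_prod_range]
    refine Finset.prod_congr (by simp) fun k _ => ?_
    simp only [add_comm 1 k, Nat.add_sub_cancel, zero_add]

/-! ### Words of bounded surplus and removal of the last letter -/

/-- The word `w` has `i` letters `0` and `j` letters `1`, and each prefix of it has at most `k`
more letters `1` than `r` times its number of letters `0`. -/
def IsBounded (r k i j : ℕ) (w : List (Fin 2)) : Prop :=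
  w.count 0 = i ∧ w.count 1 = j ∧ ∀ m, (w.take m).count 1 ≤ r * (w.take m).count 0 + k

theorem length_eq_count_add_count (w : List (Fin 2)) : w.length = w.count 0 + w.count 1 := by
  induction w with
  | nil => rfl
  | cons c l ih => fin_cases c <;> simp [ih] <;> omega

theorem finite_isBounded (r k i j : ℕ) : {w | IsBounded r k i j w}.Finite := by
  refine (List.finite_length_eq (Fin 2) (i + j)).subset ?_
  rintro w ⟨h0, h1, -⟩
  simp [length_eq_count_add_count w, h0, h1]

/-- The finite set of words that satisfy `IsBounded r k i j`. -/
def bounded (r k i j : ℕ) : Finset (List (Fin 2)) := (finite_isBounded r k i j).toFinset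

theorem mem_bounded {r k i j : ℕ} {w : List (Fin 2)} :
    w ∈ bounded r k i j ↔ IsBounded r k i j w := by
  simp [bounded]

theorem dyckPaths_eq_bounded (r n : ℕ) : dyckPaths r n = bounded r 0 n (r * n) := by
  ext w
  simp [dyckPaths, mem_bounded, IsDyckPath, IsBounded]

theorem IsBounded.le {r k i j : ℕ} {w : List (Fin 2)} (h : IsBounded r k i j w) :
    j ≤ r * i + k := by
  have := h.2.2 w.length
  rwa [List.take_length, h.1, h.2.1] at this

theorem bounded_eq_empty {r k i j : ℕ} (h : r * i + k < j) : bounded r k i j = ∅ :=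
  Finset.eq_empty_of_forall_notMem fun _ hw => absurd (mem_bounded.mp hw).le (by omega)

theorem isBounded_append_singleton {r k i j : ℕ} {w : List (Fin 2)} {c : Fin 2} :
    IsBounded r k i j (w ++ [c]) ↔ (w ++ [c]).count 0 = i ∧ (w ++ [c]).count 1 = j ∧
      j ≤ r * i + k ∧ ∀ m, (w.take m).count 1 ≤ r * (w.take m).count 0 + k := by
  constructor
  · intro h
    refine ⟨h.1, h.2.1, h.le, fun m => ?_⟩
    -- Capping m at the length keeps the prefix inside `w`, away from the appended letter.
    have := h.2.2 (min m w.length)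
    rwa [List.take_append_of_le_length (min_le_right _ _), ← List.take_eq_take_min] at this
  · rintro ⟨h0, h1, hle, h⟩
    refine ⟨h0, h1, fun m => ?_⟩
    rcases le_or_gt m w.length with hm | hm
    · rw [List.take_append_of_le_length hm]; exact h m
    · rw [List.take_of_length_le (by simpa using hm), h0, h1]; exact hle

theorem bounded_succ_zero (r k i : ℕ) :
    bounded r k (i + 1) 0 = (bounded r k i 0).image (· ++ [0]) := by
  ext w
  rw [mem_bounded, Finset.mem_image]
  constructor
  · intro h
    rcases List.eq_nil_or_concat w with rfl | ⟨u, c, rfl⟩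
    · simpa using h.1
    · rw [List.concat_eq_append] at *
      have h' := isBounded_append_singleton.mp h
      fin_cases c
      · exact ⟨u, mem_bounded.mpr ⟨by simpa using h'.1, by simpa using h'.2.1, h'.2.2.2⟩, rfl⟩
      · simpa using h'.2.1
  · rintro ⟨u, hu, rfl⟩
    obtain ⟨h0, h1, h⟩ := mem_bounded.mp hu
    exact isBounded_append_singleton.mpr ⟨by simp [h0], by simp [h1], by omega, h⟩

theorem bounded_succ_succ {r k i j : ℕ} (hj : j + 1 ≤ r * (i + 1) + k) :
    bounded r k (i + 1) (j + 1) = (bounded r k i (j + 1)).image (· ++ [0]) ∪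
      (bounded r k (i + 1) j).image (· ++ [1]) := by
  ext w
  rw [mem_bounded, Finset.mem_union, Finset.mem_image, Finset.mem_image]
  constructor
  · intro h
    rcases List.eq_nil_or_concat w with rfl | ⟨u, c, rfl⟩
    · simpa using h.1
    · rw [List.concat_eq_append] at *
      have h' := isBounded_append_singleton.mp h
      fin_cases c
      · exact .inl ⟨u, mem_bounded.mpr ⟨by simpa using h'.1, by simpa using h'.2.1, h'.2.2.2⟩, rfl⟩
      · exact .inr ⟨u, mem_bounded.mpr ⟨by simpa using h'.1, by simpa using h'.2.1, h'.2.2.2⟩, rfl⟩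
  · rintro (⟨u, hu, rfl⟩ | ⟨u, hu, rfl⟩)
    all_goals
      obtain ⟨h0, h1, h⟩ := mem_bounded.mp hu
      exact isBounded_append_singleton.mpr ⟨by simp [h0], by simp [h1], hj, h⟩

theorem sum_bounded_succ_zero {M : Type*} [AddCommMonoid M] (r k i : ℕ) (f : List (Fin 2) → M) :
    ∑ w ∈ bounded r k (i + 1) 0, f w = ∑ w ∈ bounded r k i 0, f (w ++ [0]) := by
  rw [bounded_succ_zero, Finset.sum_image fun u _ v _ h => List.append_cancel_right h]

theorem sum_bounded_succ_succ {M : Type*} [AddCommMonoid M] {r k i j : ℕ}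
    (hj : j + 1 ≤ r * (i + 1) + k) (f : List (Fin 2) → M) :
    ∑ w ∈ bounded r k (i + 1) (j + 1), f w =
      ∑ w ∈ bounded r k i (j + 1), f (w ++ [0]) + ∑ w ∈ bounded r k (i + 1) j, f (w ++ [1]) := by
  rw [bounded_succ_succ hj, Finset.sum_union, Finset.sum_image fun u _ v _ h =>
    List.append_cancel_right h, Finset.sum_image fun u _ v _ h => List.append_cancel_right h]
  rw [Finset.disjoint_left]
  simp only [Finset.mem_image]
  rintro _ ⟨u, -, rfl⟩ ⟨v, -, h⟩
  simpa using (List.append_inj' h rfl).2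

/-! ### Generating functions of path prefixes -/

/-- The generating function of the words with `i` letters `0` and `j` letters `1` all of whose
prefixes lie above the line `y = x / r`. -/
def prefixSum (r i j : ℕ) : Polynomial K :=
  ∑ w ∈ bounded r 0 i j, weight a b 0 0 0 w

/-- The part of `prefixSum r i j` from the words that end in the letter `0`. -/
def prefixSumEndZero (r i j : ℕ) : Polynomial K :=
  ∑ w ∈ bounded r 0 (i - 1) j, weight a b 0 0 0 (w ++ [0])

theorem genFun_eq_prefixSum (r n : ℕ) : genFun r n a b = prefixSum a b r n (r * n) := by
  rw [genFun, prefixSum, dyckPaths_eq_bounded]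
  exact Finset.sum_congr rfl fun w _ => prod_Des a b w

theorem bounded_zero_zero (r k : ℕ) : bounded r k 0 0 = {[]} := by
  ext w
  rw [mem_bounded, Finset.mem_singleton]
  constructor
  · rintro ⟨h0, h1, -⟩
    rw [← List.length_eq_zero_iff, length_eq_count_add_count, h0, h1]
  · rintro rfl
    simp [IsBounded]

theorem weight_append_one (p : Fin 2) (i j : ℕ) (u : List (Fin 2)) :
    weight a b p i j (u ++ [1]) = weight a b p i j u := by
  have : ¬ (1 < u.getLastD p) := by generalize u.getLastD p = c; revert c; decide
  rw [weight_append, weight, if_neg this, weight, mul_one, mul_one]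

theorem weight_append_zero_zero (p : Fin 2) (i j : ℕ) (u : List (Fin 2)) :
    weight a b p i j (u ++ [0] ++ [0]) = weight a b p i j (u ++ [0]) := by
  rw [weight_append a b p i j (u ++ [0])]
  simp [weight]

theorem weight_append_one_zero (p : Fin 2) (i j : ℕ) (u : List (Fin 2)) :
    weight a b p i j (u ++ [1] ++ [0]) =
      C (a ^ (i + u.count 0) * b ^ (j + u.count 1 + 1)) * X * weight a b p i j u := by
  rw [weight_append, weight_append_one, mul_comm]
  simp [weight, add_assoc]

theorem prefixSum_zero (r i : ℕ) : prefixSum a b r i 0 = 1 := by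
  -- Allowing p trailing zeros makes the induction on i close, since each step moves one zero into
  -- the tail.
  have h : ∀ p, ∑ w ∈ bounded r 0 i 0, weight a b 0 0 0 (w ++ List.replicate p 0) = 1 := by
    induction i with
    | zero =>
      intro p
      rw [bounded_zero_zero, Finset.sum_singleton, List.nil_append]
      suffices ∀ i, weight a b 0 i 0 (List.replicate p 0) = 1 from this 0
      induction p with
      | zero => exact fun _ => rfl
      | succ p ih => intro i; rw [List.replicate_succ, weight]; simpa using ih (i + 1)
    | succ i ih =>
      intro p
      rw [sum_bounded_succ_zero]
      simpa [List.replicate_succ] using ih (p + 1)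
  simpa [prefixSum] using h 0

theorem prefixSum_succ {r i j : ℕ} (hi : 1 ≤ i) (hj : j < r * i) :
    prefixSum a b r i (j + 1) = prefixSumEndZero a b r i (j + 1) + prefixSum a b r i j := by
  obtain ⟨i, rfl⟩ := Nat.exists_eq_add_of_le' hi
  rw [prefixSum, sum_bounded_succ_succ hj, prefixSumEndZero, prefixSum, Nat.add_sub_cancel]
  simp only [weight_append_one]

/-- Before the final 0 there are only i - 1 zeros, which cannot support more than r(i - 1) ones. -/
theorem prefixSumEndZero_eq_zero {r i j : ℕ} (hj : r * (i - 1) ≤ j) :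
    prefixSumEndZero a b r i (j + 1) = 0 := by
  rw [prefixSumEndZero, bounded_eq_empty (by omega), Finset.sum_empty]

/-- Look at the letter before the final 0: after a 0 the final letter adds no weight, after a 1 it
creates a descent at the point with i zeros and j + 1 ones. -/
theorem prefixSumEndZero_succ {r i j : ℕ} (hi : 1 ≤ i) (hj : j < r * i) :
    prefixSumEndZero a b r (i + 1) (j + 1) = prefixSumEndZero a b r i (j + 1) +
      X * C a ^ i * C b ^ (j + 1) * prefixSum a b r i j := by
  obtain ⟨i, rfl⟩ := Nat.exists_eq_add_of_le' hi
  rw [prefixSumEndZero, Nat.add_sub_cancel, sum_bounded_succ_succ hj, prefixSumEndZero, prefixSum,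
    Nat.add_sub_cancel, Finset.mul_sum]
  simp only [weight_append_one_zero, weight_append_zero_zero]
  congr 1
  refine Finset.sum_congr rfl fun w hw => ?_
  obtain ⟨h0, h1, -⟩ := mem_bounded.mp hw
  rw [h0, h1, zero_add, zero_add]
  simp only [map_mul, map_pow]
  ring

/-! ### Equivalence with the expansion -/

/-- A unit of `K` as a constant polynomial. -/
def constUnit (a : Kˣ) : K[X]ˣ := Units.map (C : K →+* K[X]) a

theorem expansionTerm_eq (r : ℕ) (a : Kˣ) (b : K) (E : ℕ → Polynomial K) (n : ℕ) :
    expansionTerm r a b E n = divSeries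
      (PowerSeries.C (((constUnit a)⁻¹ ^ n.choose 2 : K[X]ˣ) * E n) * PowerSeries.X ^ n)
      ((∏ i ∈ Finset.Icc 1 n,
          (1 + PowerSeries.C (((constUnit a)⁻¹ ^ i : K[X]ˣ) : K[X]) * PowerSeries.X)) *
        ∏ i ∈ Finset.Icc 1 (r * n), (1 + PowerSeries.C (X * C b ^ i) * PowerSeries.X)) := by
  simp only [expansionTerm, expansionDenom, constUnit, ← map_inv, ← map_pow, Units.coe_map]
  rfl

theorem genFun_satisfiesExpansion (r : ℕ) (a : Kˣ) (b : K) :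
    SatisfiesExpansion r a b fun n => genFun r n (a : K) b := by
  have h := hasFormalSum_of_rows (r := r) (a := constUnit a)
    (b := C b) (x := X) (T := prefixSum (a : K) b r) (D := prefixSumEndZero (a : K) b r)
    (fun i _ => prefixSum_zero _ _ r i) (fun i hi j hj => prefixSum_succ _ _ hi hj)
    (fun i _ j hj => prefixSumEndZero_eq_zero _ _ hj)
    (fun i hi j hj => prefixSumEndZero_succ _ _ hi hj)
  simp only [SatisfiesExpansion, expansionTerm_eq, genFun_eq_prefixSum]
  exact h

theorem genFun_zero (r : ℕ) (a b : K) : genFun r 0 a b = 1 := by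
  rw [genFun_eq_prefixSum, mul_zero, prefixSum_zero]

theorem eq_genFun_iff_satisfiesExpansion (r : ℕ) (a : Kˣ) (b : K) (E : ℕ → Polynomial K)
    (hE : E 0 = 1) :
    (∀ n, E n = genFun r n (a : K) b) ↔ SatisfiesExpansion r a b E := by
  constructor
  · intro h
    rw [funext h]
    exact genFun_satisfiesExpansion r a b
  · intro h n
    have h' := genFun_satisfiesExpansion r a b
    simp only [SatisfiesExpansion, expansionTerm_eq] at h h'
    cases n with
    | zero => rw [hE, genFun_zero]
    | succ n =>
      exact HasFormalSum.coeff_unique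
        (u := fun n => (constUnit a)⁻¹ ^ n.choose 2) (e := E) (e' := fun n => genFun r n (a : K) b)
        (g := fun n => (∏ i ∈ Finset.Icc 1 n,
          (1 + PowerSeries.C (((constUnit a)⁻¹ ^ i : K[X]ˣ) : K[X]) * PowerSeries.X)) *
        ∏ i ∈ Finset.Icc 1 (r * n), (1 + PowerSeries.C (X * C b ^ i) * PowerSeries.X)) h h' n

/-! ### First-passage decomposition -/

/-- Cut at the shortest prefix of positive surplus. Surplus increases only by one, at a letter 1, so
it is exactly 0 just before. -/
theorem exists_eq_append_of_surplus {r : ℕ} {w : List (Fin 2)}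
    (h : ∃ m, r * (w.take m).count 0 < (w.take m).count 1) :
    ∃ u v, w = u ++ 1 :: v ∧ u.count 1 = r * u.count 0 ∧
      ∀ m, (u.take m).count 1 ≤ r * (u.take m).count 0 := by
  classical
  have hm := Nat.find_spec h
  have hmin : ∀ l < Nat.find h, (w.take l).count 1 ≤ r * (w.take l).count 0 :=
    fun l hl => not_lt.mp (Nat.find_min h hl)
  generalize Nat.find h = m at hm hmin
  obtain _ | m := m
  · simp at hm
  have hmw : m < w.length := by
    by_contra hle
    rw [not_lt] at hle
    have := hmin m (by omega)
    rw [List.take_of_length_le hle] at this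
    rw [List.take_of_length_le (by omega)] at hm
    omega
  rw [List.take_add_one, List.getElem?_eq_getElem hmw] at hm
  have hu := hmin m (by omega)
  have hc : w[m] = 1 ∧ (w.take m).count 1 = r * (w.take m).count 0 := by
    generalize w[m] = c at hm
    fin_cases c
    · simp [mul_add] at hm; omega
    · simp at hm; exact ⟨rfl, by omega⟩
  refine ⟨w.take m, w.drop (m + 1), ?_, hc.2, fun l => ?_⟩
  · rw [← hc.1, ← List.drop_eq_getElem_cons hmw, List.take_append_drop]
  · rw [List.take_take]
    exact hmin _ (by omega)

/-- If one of `u`, `u'` properly extended the other, it would have a prefix consisting of a word of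
surplus 0 and a letter 1, hence of surplus 1. -/
theorem append_one_cons_injective {r : ℕ} {u v u' v' : List (Fin 2)}
    (hu : u.count 1 = r * u.count 0) (hu' : u'.count 1 = r * u'.count 0)
    (h : ∀ m, (u.take m).count 1 ≤ r * (u.take m).count 0)
    (h' : ∀ m, (u'.take m).count 1 ≤ r * (u'.take m).count 0)
    (heq : u ++ 1 :: v = u' ++ 1 :: v') : u = u' ∧ v = v' := by
  have key : ∀ {x t y y' : List (Fin 2)}, x.count 1 = r * x.count 0 →
      (∀ m, ((x ++ t).take m).count 1 ≤ r * ((x ++ t).take m).count 0) →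
      1 :: y = t ++ 1 :: y' → t = [] := by
    rintro x (_ | ⟨c, t⟩) y y' hx hxt he
    · rfl
    · rw [List.cons_append, List.cons.injEq] at he
      have := hxt (x.length + 1)
      rw [← he.1, List.take_append, List.take_of_length_le (by omega)] at this
      simp at this
      omega
  rcases List.append_eq_append_iff.mp heq with ⟨t, ht, he⟩ | ⟨t, ht, he⟩
  · obtain rfl := key hu (ht ▸ h') he
    simp_all
  · obtain rfl := key hu' (ht ▸ h) he
    simp_all

theorem IsBounded.append_one_cons {r k p q : ℕ} {u v : List (Fin 2)}
    (hu : IsBounded r 0 p (r * p) u) (hv : IsBounded r k q (r * q + k) v) :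
    IsBounded r (k + 1) (p + q) (r * (p + q) + (k + 1)) (u ++ 1 :: v) := by
  refine ⟨by simp [hu.1, hv.1], by simp [hu.2.1, hv.2.1]; ring, fun m => ?_⟩
  rw [List.take_append, List.count_append, List.count_append]
  rcases le_or_gt m u.length with hm | hm
  · rw [Nat.sub_eq_zero_of_le hm]
    have := hu.2.2 m
    simp
    omega
  · obtain ⟨l, hl⟩ := Nat.exists_eq_add_of_lt hm
    rw [hl, show u.length + l + 1 - u.length = l + 1 by omega, List.take_of_length_le (by omega),
      hu.1, hu.2.1, mul_add]
    have := hv.2.2 l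
    simp
    omega

theorem IsBounded.of_append_one_cons {r k n : ℕ} {u v : List (Fin 2)}
    (h : IsBounded r (k + 1) n (r * n + (k + 1)) (u ++ 1 :: v))
    (hu : u.count 1 = r * u.count 0) :
    u.count 0 + v.count 0 = n ∧ IsBounded r k (v.count 0) (r * v.count 0 + k) v := by
  have h0 : u.count 0 + v.count 0 = n := by simpa using h.1
  refine ⟨h0, rfl, ?_, fun m => ?_⟩
  · have h1 := h.2.1
    rw [← h0] at h1
    simp [hu, mul_add] at h1
    omega
  · have h2 := h.2.2 (u.length + (m + 1))
    rw [List.take_length_add_append] at h2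
    simp [hu, mul_add] at h2
    omega

/-- First-passage decomposition: a word that ends with surplus `k + 1` is a Dyck path, followed
by the letter `1`, followed by a word that ends with surplus `k`. -/
theorem sum_bounded_add_one {M : Type*} [AddCommMonoid M] (r k n : ℕ) (f : List (Fin 2) → M) :
    ∑ w ∈ bounded r (k + 1) n (r * n + (k + 1)), f w =
      ∑ pq ∈ Finset.HasAntidiagonal.antidiagonal n, ∑ u ∈ bounded r 0 pq.1 (r * pq.1),
        ∑ v ∈ bounded r k pq.2 (r * pq.2 + k), f (u ++ 1 :: v) := by
  simp_rw [← Finset.sum_product']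
  rw [Finset.sum_sigma']
  symm
  refine Finset.sum_bij (fun s _ => s.2.1 ++ 1 :: s.2.2) ?_ ?_ ?_ ?_
  · rintro ⟨⟨p, q⟩, u, v⟩ hs
    simp only [Finset.mem_sigma, Finset.HasAntidiagonal.mem_antidiagonal,
      Finset.mem_product, mem_bounded] at hs ⊢
    obtain ⟨rfl, hu, hv⟩ := hs
    exact hu.append_one_cons hv
  · rintro ⟨⟨p, q⟩, u, v⟩ hs ⟨⟨p', q'⟩, u', v'⟩ hs' heq
    simp only [Finset.mem_sigma, Finset.HasAntidiagonal.mem_antidiagonal,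
      Finset.mem_product, mem_bounded] at hs hs'
    obtain ⟨-, ⟨rfl, hu1, hu⟩, ⟨rfl, -⟩⟩ := hs
    obtain ⟨-, ⟨rfl, hu1', hu'⟩, ⟨rfl, -⟩⟩ := hs'
    obtain ⟨rfl, rfl⟩ := append_one_cons_injective hu1 hu1' hu hu' heq
    rfl
  · intro w hw
    rw [mem_bounded] at hw
    obtain ⟨u, v, rfl, hu1, hu⟩ := exists_eq_append_of_surplus (r := r) (w := w)
      ⟨w.length, by rw [List.take_length, hw.1, hw.2.1]; omega⟩
    obtain ⟨h0, hv⟩ := hw.of_append_one_cons hu1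
    refine ⟨⟨(u.count 0, v.count 0), u, v⟩, ?_, rfl⟩
    simp only [Finset.mem_sigma, Finset.HasAntidiagonal.mem_antidiagonal,
      Finset.mem_product, mem_bounded]
    exact ⟨h0, ⟨rfl, hu1, hu⟩, hv⟩
  · exact fun _ _ => rfl

/-- The initial 0 supplies an allowance of r further ones. -/
theorem isBounded_cons_zero {r n : ℕ} {v : List (Fin 2)} :
    IsBounded r 0 (n + 1) (r * (n + 1)) (0 :: v) ↔ IsBounded r r n (r * n + r) v := by
  refine and_congr (by simp) (and_congr (by simp [mul_add]) ⟨fun h m => ?_, fun h m => ?_⟩)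
  · simpa [mul_add] using h (m + 1)
  · cases m with
    | zero => simp
    | succ m => simpa [mul_add] using h m

theorem IsBounded.exists_eq_cons_zero {r i j : ℕ} {w : List (Fin 2)}
    (h : IsBounded r 0 (i + 1) j w) : ∃ v, w = 0 :: v := by
  obtain _ | ⟨c, v⟩ := w
  · simpa using h.1
  · have := h.2.2 1
    fin_cases c
    · exact ⟨v, rfl⟩
    · simp at this

theorem sum_bounded_zero_succ {M : Type*} [AddCommMonoid M] (r n : ℕ) (f : List (Fin 2) → M) :
    ∑ w ∈ bounded r 0 (n + 1) (r * (n + 1)), f w =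
      ∑ v ∈ bounded r r n (r * n + r), f (0 :: v) := by
  symm
  refine Finset.sum_bij (fun v _ => 0 :: v) ?_ ?_ ?_ ?_
  · intro v hv
    exact mem_bounded.mpr (isBounded_cons_zero.mpr (mem_bounded.mp hv))
  · intro v _ v' _ h
    exact (List.cons.inj h).2
  · intro w hw
    obtain ⟨v, rfl⟩ := (mem_bounded.mp hw).exists_eq_cons_zero
    exact ⟨v, mem_bounded.mpr (isBounded_cons_zero.mp (mem_bounded.mp hw)), rfl⟩
  · exact fun _ _ => rfl

/-! ### Equivalence with the recurrence -/

/-- The generating function of the words with `n` letters `0` and surplus `k`, read after a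
letter `1` from the point with `i` letters `0` and `j` letters `1` before it. -/
def surplusSum (r k n i j : ℕ) : Polynomial K :=
  ∑ w ∈ bounded r k n (r * n + k), weight a b 1 i j w

/-- Source of δ(n > 0): a nonempty Dyck path starts with 0, so reading it after a 1 adds a descent
at its starting point. -/
theorem surplusSum_zero (r n i j : ℕ) :
    surplusSum a b r 0 n i j = scaleVar (a ^ i * b ^ j) (genFun r n a b) *
      (C (a ^ i * b ^ j) * X) ^ (if 0 < n then 1 else 0) := by
  rw [genFun_eq_prefixSum, prefixSum, scaleVar, ← coe_compRingHom_apply, map_sum, surplusSum,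
    Finset.sum_mul]
  refine Finset.sum_congr rfl fun w hw => ?_
  rw [coe_compRingHom_apply, ← scaleVar, scaleVar_weight]
  rw [mem_bounded] at hw
  obtain _ | n := n
  · rw [mul_zero, ← mem_bounded, bounded_zero_zero, Finset.mem_singleton] at hw
    simp [hw, weight]
  · obtain ⟨v, rfl⟩ := hw.exists_eq_cons_zero
    simp [weight, mul_comm]

theorem weight_append_one_cons (p : Fin 2) (i j : ℕ) (u v : List (Fin 2)) :
    weight a b p i j (u ++ 1 :: v) =
      weight a b p i j u * weight a b 1 (i + u.count 0) (j + u.count 1 + 1) v := by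
  have h : u ++ 1 :: v = (u ++ [1]) ++ v := by simp
  rw [h, weight_append, weight_append_one, List.getLastD_concat]
  simp [add_assoc]

theorem surplusSum_succ (r k n i j : ℕ) :
    surplusSum a b r (k + 1) n i j = ∑ pq ∈ Finset.HasAntidiagonal.antidiagonal n,
      surplusSum a b r 0 pq.1 i j * surplusSum a b r k pq.2 (i + pq.1) (j + r * pq.1 + 1) := by
  rw [surplusSum, sum_bounded_add_one]
  refine Finset.sum_congr rfl fun pq _ => ?_
  rw [surplusSum, surplusSum, Finset.sum_mul_sum]
  refine Finset.sum_congr rfl fun u hu => Finset.sum_congr rfl fun v _ => ?_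
  obtain ⟨h0, h1, -⟩ := mem_bounded.mp hu
  rw [weight_append_one_cons, h0, h1, add_zero]

theorem sum_antidiagonalTuple_succ {M : Type*} [AddCommMonoid M] (k n : ℕ)
    (f : (Fin (k + 1) → ℕ) → M) :
    ∑ m ∈ Finset.Nat.antidiagonalTuple (k + 1) n, f m =
      ∑ pq ∈ Finset.HasAntidiagonal.antidiagonal n, ∑ m ∈ Finset.Nat.antidiagonalTuple k pq.2,
        f (Fin.cons pq.1 m) := by
  rw [Finset.sum_sigma']
  refine Finset.sum_bij' (fun m _ => ⟨(m 0, ∑ i : Fin k, m i.succ), Fin.tail m⟩)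
    (fun s _ => Fin.cons s.1.1 s.2) ?_ ?_ ?_ ?_ ?_
  · intro m hm
    rw [Finset.Nat.mem_antidiagonalTuple, Fin.sum_univ_succ] at hm
    simpa [Finset.Nat.mem_antidiagonalTuple, Fin.tail] using hm
  · rintro ⟨⟨p, q⟩, m⟩ hs
    simp only [Finset.mem_sigma, Finset.HasAntidiagonal.mem_antidiagonal,
      Finset.Nat.mem_antidiagonalTuple] at hs
    rw [Finset.Nat.mem_antidiagonalTuple, Fin.sum_univ_succ]
    simpa [hs.2] using hs.1
  · intro m _
    exact Fin.cons_self_tail m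
  · rintro ⟨⟨p, q⟩, m⟩ hs
    simp only [Finset.mem_sigma, Finset.HasAntidiagonal.mem_antidiagonal,
      Finset.Nat.mem_antidiagonalTuple] at hs
    simp [← hs.2]
  · intro m _
    simp

theorem sum_filter_lt_succ_cons {k : ℕ} (p : ℕ) (m : Fin k → ℕ) (t : Fin k) :
    ∑ s ∈ Finset.univ.filter (· < t.succ), (Fin.cons p m : Fin (k + 1) → ℕ) s =
      p + ∑ s ∈ Finset.univ.filter (· < t), m s := by
  rw [Finset.sum_filter, Finset.sum_filter, Fin.sum_univ_succ]
  simp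

/-- First passage iterated k times: Dyck factor t starts after all earlier factors and t separating
ones. -/
theorem surplusSum_eq_sum (r k n i j : ℕ) :
    surplusSum a b r k n i j = ∑ m ∈ Finset.Nat.antidiagonalTuple (k + 1) n,
      ∏ t : Fin (k + 1), surplusSum a b r 0 (m t)
        (i + ∑ s ∈ Finset.univ.filter (· < t), m s)
        (j + t + r * ∑ s ∈ Finset.univ.filter (· < t), m s) := by
  induction k generalizing n i j with
  | zero => simp
  | succ k ih =>
    rw [surplusSum_succ, sum_antidiagonalTuple_succ]
    refine Finset.sum_congr rfl fun pq _ => ?_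
    rw [ih, Finset.mul_sum]
    refine Finset.sum_congr rfl fun m _ => ?_
    rw [Fin.prod_univ_succ (n := k + 1)]
    congr 1
    · simp
    · refine Finset.prod_congr rfl fun t _ => ?_
      rw [sum_filter_lt_succ_cons, Fin.cons_succ, Fin.val_succ]
      congr 1 <;> ring

/-- Without its initial 0 the path ends with surplus r, hence splits into r + 1 Dyck factors. Factor
0 follows a 0, so no descent arises there and only x ↦ ax remains. -/
theorem genFun_succ (r n : ℕ) (hr : 1 ≤ r) :
    genFun r (n + 1) a b = ∑ m ∈ Finset.Nat.antidiagonalTuple (r + 1) n,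
      scaleVar a (genFun r (m 0) a b) *
        ∏ i : Fin r, surplusSum a b r 0 (m i.succ) (d1 m i.succ) (d2 m i.succ) := by
  obtain ⟨k, rfl⟩ := Nat.exists_eq_add_of_le' hr
  rw [genFun_eq_prefixSum, prefixSum, sum_bounded_zero_succ, sum_bounded_add_one,
    sum_antidiagonalTuple_succ]
  refine Finset.sum_congr rfl fun pq _ => ?_
  have h : ∀ u ∈ bounded (k + 1) 0 pq.1 ((k + 1) * pq.1),
      ∑ v ∈ bounded (k + 1) k pq.2 ((k + 1) * pq.2 + k), weight a b 0 0 0 (0 :: (u ++ 1 :: v)) =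
      scaleVar a (weight a b 0 0 0 u) *
        surplusSum a b (k + 1) k pq.2 (1 + pq.1) ((k + 1) * pq.1 + 1) := by
    intro u hu
    obtain ⟨h0, h1, -⟩ := mem_bounded.mp hu
    rw [surplusSum, Finset.mul_sum]
    refine Finset.sum_congr rfl fun v _ => ?_
    have hs := scaleVar_weight a b 1 0 0 0 0 u
    rw [pow_one, pow_zero, mul_one] at hs
    rw [hs, weight, weight_append_one_cons, h0, h1]
    simp
  rw [Finset.sum_congr rfl h, ← Finset.sum_mul, surplusSum_eq_sum, Finset.mul_sum]
  refine Finset.sum_congr rfl fun m _ => ?_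
  congr 1
  · rw [genFun_eq_prefixSum, Fin.cons_zero, prefixSum, scaleVar, ← coe_compRingHom_apply, map_sum]
    rfl
  · refine Finset.prod_congr rfl fun t _ => ?_
    rw [d1, d2, sum_filter_lt_succ_cons, Fin.cons_succ, Fin.val_succ]
    congr 1 <;> ring

theorem genFun_satisfiesRecurrence (r : ℕ) (hr : 1 ≤ r) :
    SatisfiesRecurrence r a b fun n => genFun r n a b := by
  intro n
  simp only [genFun_succ a b r n hr, surplusSum_zero]

theorem SatisfiesRecurrence.unique {r : ℕ} {E E' : ℕ → Polynomial K}
    (h : SatisfiesRecurrence r a b E) (h' : SatisfiesRecurrence r a b E') (h0 : E 0 = E' 0)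
    (n : ℕ) : E n = E' n := by
  induction n using Nat.strong_induction_on with
  | _ n ih =>
    obtain _ | n := n
    · exact h0
    rw [h n, h' n]
    refine Finset.sum_congr rfl fun m hm => ?_
    -- All parts are at most n, so the right side involves only earlier polynomials.
    have hle : ∀ i, m i < n + 1 := fun i => by
      rw [Finset.Nat.mem_antidiagonalTuple] at hm
      have := Finset.single_le_sum (f := m) (fun _ _ => Nat.zero_le _) (Finset.mem_univ i)
      omega
    simp only [fun i => ih (m i) (hle i)]

theorem eq_genFun_iff_satisfiesRecurrence (r : ℕ) (hr : 1 ≤ r) (E : ℕ → Polynomial K)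
    (hE : E 0 = 1) : (∀ n, E n = genFun r n a b) ↔ SatisfiesRecurrence r a b E := by
  constructor
  · intro h
    rw [funext h]
    exact genFun_satisfiesRecurrence a b r hr
  · intro h
    exact h.unique a b (genFun_satisfiesRecurrence a b r hr) (by rw [hE, genFun_zero])

/-! ### Specialization to the major index -/

/-- A position i is the number of zeros plus the number of ones among the first i letters. -/
theorem maj_eq_alpha_add_beta (w : List (Fin 2)) : maj w = alpha w + beta w := by
  rw [maj, alpha, beta, ← Finset.sum_add_distrib]
  refine Finset.sum_congr rfl fun i hi => ?_
  rw [← length_eq_count_add_count, List.length_take]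
  rw [Des, Finset.mem_filter, Finset.mem_Ico] at hi
  omega

theorem eval_one_genFun (r n : ℕ) (q : K) :
    (genFun r n q q).eval 1 = ∑ d ∈ dyckPaths r n, q ^ maj d := by
  rw [genFun, eval_finsetSum]
  exact Finset.sum_congr rfl fun d _ => by simp [maj_eq_alpha_add_beta, pow_add]

theorem prod_Icc_one_eq_prod_range {R : Type*} [CommMonoid R] (f : ℕ → R) (n : ℕ) :
    ∏ i ∈ Finset.Icc 1 n, f i = ∏ i ∈ Finset.range n, f (i + 1) := by
  induction n with
  | zero => simp
  | succ n ih => rw [Finset.prod_Icc_succ_top (by omega), ih, Finset.prod_range_succ]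

theorem qPochhammer_neg_eq_prod (q : K) (n : ℕ) :
    qPochhammer (-(PowerSeries.C q * PowerSeries.X)) (PowerSeries.C q) n =
      ∏ i ∈ Finset.Icc 1 n, (1 + PowerSeries.C (q ^ i) * PowerSeries.X) := by
  rw [qPochhammer, prod_Icc_one_eq_prod_range]
  refine Finset.prod_congr rfl fun i _ => ?_
  rw [pow_succ, map_mul, map_pow]
  ring

theorem qPochhammer_neg_inv_eq_prod (q : Kˣ) (n : ℕ) :
    qPochhammer (-(PowerSeries.C ((q⁻¹ ^ n : Kˣ) : K) * PowerSeries.X))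
        (PowerSeries.C (q : K)) n =
      ∏ i ∈ Finset.Icc 1 n, (1 + PowerSeries.C ((q⁻¹ ^ i : Kˣ) : K) * PowerSeries.X) := by
  rw [qPochhammer, prod_Icc_one_eq_prod_range, ← Finset.prod_range_reflect]
  refine Finset.prod_congr rfl fun i hi => ?_
  rw [Finset.mem_range] at hi
  -- The Pochhammer factors come in the order q^(-n), …, q^(-1), hence the reflection of the index.
  have h : (q : K) ^ (n - 1 - i) * ((q⁻¹ ^ n : Kˣ) : K) = ((q⁻¹ ^ (i + 1) : Kˣ) : K) := by
    obtain ⟨l, rfl⟩ := Nat.exists_eq_add_of_lt hi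
    rw [show i + l + 1 - 1 - i = l by omega, ← Units.val_pow_eq_pow_val, ← Units.val_mul,
      show i + l + 1 = l + (i + 1) by omega, pow_add, ← mul_assoc, inv_pow q l, mul_inv_cancel,
      one_mul]
  rw [← h, map_mul, map_pow]
  ring

theorem satisfiesQExpansion_iff (r : ℕ) (q : Kˣ) (e : ℕ → K) :
    SatisfiesQExpansion r q e ↔ HasFormalSum (fun k => divSeries
      (PowerSeries.C (((q⁻¹ ^ (k + 1).choose 2 : Kˣ) : K) * e (k + 1)) * PowerSeries.X ^ (k + 1))
      ((∏ i ∈ Finset.Icc 1 (k + 1),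
          (1 + PowerSeries.C ((q⁻¹ ^ i : Kˣ) : K) * PowerSeries.X)) *
        ∏ i ∈ Finset.Icc 1 (r * (k + 1)),
          (1 + PowerSeries.C ((q : K) ^ i) * PowerSeries.X))) PowerSeries.X := by
  simp only [SatisfiesQExpansion, qPochhammer_neg_eq_prod, qPochhammer_neg_inv_eq_prod]

theorem HasFormalSum.map {R S : Type*} [CommRing R] [CommRing S] (φ : R →+* S)
    {f : ℕ → PowerSeries R} {s : PowerSeries R} (hf : ∀ k, PowerSeries.X ^ (k + 1) ∣ f k)
    (h : HasFormalSum f s) :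
    HasFormalSum (fun k => PowerSeries.map φ (f k)) (PowerSeries.map φ s) := by
  rw [hasFormalSum_iff hf] at h
  rw [hasFormalSum_iff fun k => by simpa using map_dvd (PowerSeries.map φ) (hf k)]
  intro d
  simp only [PowerSeries.coeff_map, ← map_sum, h d]

/-- Image of the polynomial expansion at a = b = q under evaluation of each coefficient at x = 1. -/
theorem sum_maj_satisfiesQExpansion (r : ℕ) (q : Kˣ) :
    SatisfiesQExpansion r q fun n => ∑ d ∈ dyckPaths r n, (q : K) ^ maj d := by
  have h := (genFun_satisfiesExpansion r q (q : K)).map (evalRingHom 1)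
    fun k => X_pow_dvd_divSeries _ _ _
  rw [satisfiesQExpansion_iff]
  convert h using 1
  · ext1 k
    rw [map_divSeries]
    · simp [expansionDenom, map_prod, eval_one_genFun]
    · rw [expansionDenom, map_mul, constantCoeff_prod_one_add, constantCoeff_prod_one_add, one_mul]
  · simp

theorem satisfiesQExpansion_iff_sum_maj (r : ℕ) (q : Kˣ) (e : ℕ → K) (he : e 0 = 1) :
    SatisfiesQExpansion r q e ↔ ∀ n, ∑ d ∈ dyckPaths r n, (q : K) ^ maj d = e n := by
  have hq := sum_maj_satisfiesQExpansion r q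
  constructor
  · intro h n
    obtain _ | n := n
    · rw [← eval_one_genFun, genFun_zero, eval_one, he]
    · rw [satisfiesQExpansion_iff] at h hq
      exact HasFormalSum.coeff_unique (u := fun n => q⁻¹ ^ n.choose 2)
        (e := fun n => ∑ d ∈ dyckPaths r n, (q : K) ^ maj d) (e' := e)
        (g := fun n => (∏ i ∈ Finset.Icc 1 n,
            (1 + PowerSeries.C ((q⁻¹ ^ i : Kˣ) : K) * PowerSeries.X)) *
          ∏ i ∈ Finset.Icc 1 (r * n), (1 + PowerSeries.C ((q : K) ^ i) * PowerSeries.X)) hq h n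
  · intro h
    rwa [← funext h]

end RDyck
end

theorem mainTheorem11 {K : Type*} [CommRing K] (r : ℕ) (hr : 1 ≤ r) :
    (∀ (a : Kˣ) (b : K) (E : ℕ → Polynomial K), E 0 = 1 →
      List.TFAE [
        ∀ n, E n = RDyck.genFun r n (a : K) b,
        RDyck.SatisfiesExpansion r a b E,
        RDyck.SatisfiesRecurrence r (a : K) b E]) ∧
    (∀ (q : Kˣ) (e : ℕ → K), e 0 = 1 →
      (RDyck.SatisfiesQExpansion r q e ↔
        ∀ n, ∑ d ∈ RDyck.dyckPaths r n, (q : K) ^ RDyck.maj d = e n)) ∧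
    (∀ (q : K) (n : ℕ),
      (RDyck.genFun r n q q).eval 1 =
        ∑ d ∈ RDyck.dyckPaths r n, q ^ RDyck.maj d) := by
  refine ⟨fun a b E hE => ?_, fun q e he => RDyck.satisfiesQExpansion_iff_sum_maj r q e he,
    fun q n => RDyck.eval_one_genFun r n q⟩
  tfae_have 1 ↔ 2 := RDyck.eq_genFun_iff_satisfiesExpansion r a b E hE
  tfae_have 1 ↔ 3 := RDyck.eq_genFun_iff_satisfiesRecurrence (a : K) b r hr E hE
  tfae_finish
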